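/- Let $\Lambda$ be a basic artin algebra (an algebra that is finitely generated as a module over a commutative artinian ring) which is a linear Nakayama algebra with $n\ge 1$ simple modules. That is, all indecomposable projective and all indecomposable injective left $\Lambda$-modules are uniserial, and the ordinary quiver of $\Lambda$ is of type $A_n$ with straight orientation, its vertices being labelled so that its arrows are exactly $i+1\to i$ for $1\le i\le n-1$. Here there is an arrow $i\to j$ when $e_j(\operatorname{rad}\Lambda/\operatorname{rad}^2\Lambda)e_i\neq 0$, where $e_1,\dots,e_n$ are the corresponding primitive orthogonal idempotents with sum $1$. Let $P_i=\Lambda e_i$ be the indecomposable projective left module at vertex $i$ and let $c=(c_1,\dots,c_n)$, $c_i=l(P_i)$ (the length of $P_i$), be the admissible sequence of $\Lambda$. Put $$\mathcal Q_c=\{i\in\{1,\dots,n\}\mid c_{i+1}\le c_i\},\qquad \mathcal P_c=\{i\in\{1,\dots,n\}\mid c_{i+1}=c_i+1\},$$ where $c_{n+1}:=c_1$. For a left module $M$ with minimal injective resolution $0\to M\to I_0\to I_1\to\cdots$ let $\operatorname{dom.dim} M=\sup\{k\mid I_i\text{ is projective for all }0\le i<k\}$, and let $\operatorname{dom.dim}\Lambda$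 be the dominant dimension of the left module ${}_\Lambda\Lambda$. Then $$\operatorname{dom.dim}\Lambda\ge 2\iff \mathcal P_c\subseteq\{\,j-c_j\mid j\in\mathcal Q_c\,\}$$ as sets of integers. -/

import Mathlib

universe u v

namespace NakayamaDomDim

section Modules

variable (A : Type u) [Ring A] (M : Type v) [AddCommGroup M] [Module A M]

/-- A module is indecomposable if it is nonzero and is not the direct sum of two nonzero
submodules. -/
def IsIndecomposable : Prop :=
  Nontrivial M ∧ ∀ N N' : Submodule A M, IsCompl N N' → N = ⊥ ∨ N' = ⊥

/-- A module is uniserial if its submodules are totally ordered by inclusion. -/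
def IsUniserial : Prop :=
  ∀ N N' : Submodule A M, N ≤ N' ∨ N' ≤ N

variable {A M}

/-- A submodule is essential if it meets every nonzero submodule nontrivially. -/
def IsEssential (N : Submodule A M) : Prop :=
  ∀ K : Submodule A M, N ⊓ K = ⊥ → K = ⊥

end Modules

section DominantDimension

variable (A : Type u) [Ring A] (M : Type u) [AddCommGroup M] [Module A M]

/-- A minimal injective resolution `0 → M → I₀ → I₁ → ⋯` of a left module: an exact sequence with
every `Iₖ` injective, such that `I₀` is an injective envelope of `M` and `Iₖ₊₁` is an injective
envelope of the image of `Iₖ → Iₖ₊₁`. -/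
structure MinimalInjectiveResolution where
  /-- the terms `Iₖ` -/
  obj : ℕ → ModuleCat.{u} A
  /-- the coaugmentation `M → I₀` -/
  ι : M →ₗ[A] obj 0
  /-- the differentials `Iₖ → Iₖ₊₁` -/
  d : ∀ k, obj k →ₗ[A] obj (k + 1)
  injective_obj : ∀ k, Module.Injective A (obj k)
  injective_ι : Function.Injective ι
  exact_zero : Function.Exact ι (d 0)
  exact_succ : ∀ k, Function.Exact (d k) (d (k + 1))
  essential_zero : IsEssential (LinearMap.range ι)
  essential_succ : ∀ k, IsEssential (LinearMap.range (d k))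

/-- The dominant dimension of a left module `M`: the supremum in `ℕ ∪ {∞}` of all `k` such that in
a minimal injective resolution of `M` the terms `Iᵢ` with `i < k` are projective. (Minimal
injective resolutions exist and are unique up to isomorphism.) -/
noncomputable def dominantDimension : ℕ∞ :=
  sSup {k : ℕ∞ | ∃ I : MinimalInjectiveResolution A M,
    ∀ i : ℕ, (i : ℕ∞) < k → Module.Projective A (I.obj i)}

end DominantDimension

section Algebras

variable (A : Type u) [Ring A]

/-- The uniseriality condition defining Nakayama algebras: all indecomposable projective and all
indecomposable injective left modules are uniserial. (Over an artin algebra these modules are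
automatically finitely generated.) -/
structure IsNakayama : Prop where
  projective : ∀ (P : Type u) [AddCommGroup P] [Module A P],
    Module.Projective A P → IsIndecomposable A P → IsUniserial A P
  injective : ∀ (I : Type u) [AddCommGroup I] [Module A I],
    Module.Injective A I → IsIndecomposable A I → IsUniserial A I

variable {A} {n : ℕ}

/-- The left projective module `P_i = A e_i`. -/
def proj (e : Fin n → A) (i : Fin n) : Submodule A A := Submodule.span A {e i}

/-- `e` is a complete family of pairwise orthogonal primitive idempotents for which the
indecomposable projective modules `A e_i` are pairwise non-isomorphic. Such a family exists exactly
when the artin algebra `A` is basic, and then the `A e_i` represent the isomorphism classes of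
indecomposable projective modules. -/
structure IsBasicFamily (e : Fin n → A) : Prop where
  complete : CompleteOrthogonalIdempotents e
  indecomposable : ∀ i, IsIndecomposable A (proj e i)
  eq_of_iso : ∀ i j, Nonempty (proj e i ≃ₗ[A] proj e j) → i = j

/-- There is an arrow `i → j` in the ordinary quiver of the basic algebra `A` (for left modules):
`e_j (rad A / rad² A) e_i ≠ 0`. -/
def HasArrow (e : Fin n → A) (i j : Fin n) : Prop :=
  ∃ x ∈ Ring.jacobson A, e j * x * e i ∉ Ring.jacobson A ^ 2

/-- `A` is a linear Nakayama algebra with respect to the labelling given by the idempotents `e`: it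
is basic and Nakayama, and the arrows of its ordinary quiver are exactly `i + 1 → i`, so that the
quiver is `A_n` with straight orientation. The vertices `1, …, n` correspond, in this order, to the
elements `0, …, n - 1` of `Fin n`. (Connectedness of `A` is that of the quiver.) -/
structure IsLinearNakayama (e : Fin n → A) : Prop where
  basic : IsBasicFamily e
  nakayama : IsNakayama A
  arrow_iff : ∀ i j : Fin n, HasArrow e i j ↔ (i : ℕ) = (j : ℕ) + 1

/-- The admissible sequence `c_i = l(P_i)`, the length of the module `P_i`. -/
noncomputable def admissibleSequence (e : Fin n → A) (i : Fin n) : ℕ :=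
  (Module.length A (proj e i)).toNat

end Algebras

section Combinatorics

variable {n : ℕ} [NeZero n] (c : Fin n → ℕ)

/-- The number in `{1, …, n}` of the vertex that corresponds to an element of `Fin n`. -/
def label (i : Fin n) : ℤ := (i : ℤ) + 1

/-- `Q_c = {i | c_{i+1} ≤ c_i}`, with indices modulo `n` (addition in `Fin n` is cyclic). -/
def indexQ : Set (Fin n) := {i | c (i + 1) ≤ c i}

/-- `P_c = {i | c_{i+1} = c_i + 1}`, with indices modulo `n`. -/
def indexP : Set (Fin n) := {i | c (i + 1) = c i + 1}

end Combinatorics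

end NakayamaDomDim

/-! Write P_a = A e_a and S_a for its top. An arrow x_a generates rad P_{a+1}, so right
multiplication by x_a maps P_a onto rad P_{a+1}. If this map is injective, then c_{a+1} = c_a + 1.
Otherwise c_{a+1} ≤ c_a and P_a is an injective module (`injective_of_not_arrowInjective`). Thus P_c
and Q_c record which arrows are injective (`mem_indexP_iff`, `mem_indexQ_iff`).

Every nonzero element of P_j generates the same left ideal as a path. If the path generating the
socle ends in a, then P_j has length j - a + 1 (`length_of_isSoclePath`). So i = j - c_j says that
the socle of P_j is S_{i+1}, and the combinatorial inclusion becomes `SocleCondition`.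

If the arrow at i is injective, P_i = rad P_{i+1}, and composing injective arrows embeds P_{i+1} in
a projective injective P_q. The cokernel P_q/P_i is uniserial with socle P_{i+1}/P_i = S_{i+1}, so
the next term of the resolution is the envelope of S_{i+1}. It is projective exactly when S_{i+1} is
the socle of a projective injective P_j. The two directions are `socleCondition_of_two_le` and
`two_le_of_socleCondition`. -/

namespace NakayamaDomDim

/-! ### Injective envelopes, minimal injective resolutions and dominant dimension at least two. -/

section InjectiveHulls

variable {A : Type u} [Ring A]

lemma injective_of_retract {E K : Type u} [AddCommGroup E] [Module A E] [AddCommGroup K]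
    [Module A K] (hE : Module.Injective A E) (i : K →ₗ[A] E) (r : E →ₗ[A] K)
    (h : ∀ x, r (i x) = x) : Module.Injective A K where
  out X Y _ _ _ _ f hf g := by
    obtain ⟨l, hl⟩ := hE.out f hf (i ∘ₗ g)
    exact ⟨r ∘ₗ l, fun x => by simp [hl, h]⟩

lemma exists_maximal_disjoint {M : Type*} [AddCommGroup M] [Module A M] (N C : Submodule A M)
    (h : N ⊓ C = ⊥) :
    ∃ K, N ≤ K ∧ K ⊓ C = ⊥ ∧ ∀ K', K ≤ K' → K' ⊓ C = ⊥ → K' = K := by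
  obtain ⟨K, hNK, hK⟩ := zorn_le_nonempty₀ {K : Submodule A M | K ⊓ C = ⊥} (by
    intro c hc hchain y hy
    refine ⟨sSup c, ?_, fun z hz => le_sSup hz⟩
    change sSup c ⊓ C = ⊥
    rw [eq_bot_iff]
    rintro x ⟨hx, hxC⟩
    obtain ⟨z, hz, hxz⟩ := (Submodule.mem_sSup_of_directed ⟨y, hy⟩ hchain.directedOn).1 hx
    rw [← show z ⊓ C = ⊥ from hc hz]
    exact ⟨hxz, hxC⟩) N h
  exact ⟨K, hNK, hK.1, fun K' hle h' => le_antisymm (hK.2 h' hle) hle⟩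

lemma injective_of_injective_comp {M E F : Type*} [AddCommGroup M] [Module A M] [AddCommGroup E]
    [Module A E] [AddCommGroup F] [Module A F] {ι : M →ₗ[A] E} (hι : IsEssential (LinearMap.range ι))
    {φ : E →ₗ[A] F} (h : ∀ x, φ (ι x) = 0 → ι x = 0) : Function.Injective φ := by
  rw [← LinearMap.ker_eq_bot]
  apply hι
  rw [eq_bot_iff]
  rintro _ ⟨⟨x, rfl⟩, hx⟩
  simpa using h x (by simpa using hx)

/-- Take C maximal with N ∩ C = 0, then K ⊇ N maximal with K ∩ C = 0. Maximality of C makes N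
essential in K and K essential in E/C. The inclusion of K extends to an embedding g of E/C in E; its
image contains K and misses C, so it equals K, and E → E/C → K is a retraction. -/
lemma exists_injective_essential_le {E : Type u} [AddCommGroup E] [Module A E]
    (hE : Module.Injective A E) (N : Submodule A E) :
    ∃ K : Submodule A E, N ≤ K ∧ Module.Injective A K ∧ ∀ L ≤ K, N ⊓ L = ⊥ → L = ⊥ := by
  obtain ⟨C, -, hCN, hCmax⟩ := exists_maximal_disjoint (⊥ : Submodule A E) N (by simp)
  obtain ⟨K, hNK, hKC, hKmax⟩ := exists_maximal_disjoint N C (by rwa [inf_comm])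
  have hess : ∀ L ≤ K, N ⊓ L = ⊥ → L = ⊥ := by
    intro L hL hNL
    have h1 : C ⊔ L = C := by
      apply hCmax _ le_sup_left
      rw [eq_bot_iff]
      rintro x ⟨hx, hxN⟩
      obtain ⟨c, hc, l, hl, rfl⟩ := Submodule.mem_sup.1 hx
      have hcK : c ∈ K := by
        have := K.sub_mem (hNK hxN) (hL hl)
        simpa using this
      have hc0 : c ∈ (⊥ : Submodule A E) := by rw [← hKC]; exact ⟨hcK, hc⟩
      rw [← hNL]
      rw [Submodule.mem_bot] at hc0
      subst hc0
      refine ⟨hxN, by simpa using hl⟩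
    rw [eq_bot_iff, ← hKC]
    exact le_inf hL (h1 ▸ le_sup_right)
  let p : K →ₗ[A] E ⧸ C := C.mkQ ∘ₗ K.subtype
  have hp : Function.Injective p := by
    rw [← LinearMap.ker_eq_bot, eq_bot_iff]
    intro x hx
    have hxC : (x : E) ∈ C := by simpa [p] using hx
    have : (x : E) ∈ K ⊓ C := ⟨x.2, hxC⟩
    rw [hKC] at this
    simpa using this
  have hpess : IsEssential (LinearMap.range p) := by
    intro D hD
    have h1 : D.comap C.mkQ = C := by
      apply hCmax _ (fun c hc => by simp [(Submodule.Quotient.mk_eq_zero C).2 hc])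
      rw [eq_bot_iff]
      rintro x ⟨hxD, hxN⟩
      have : p ⟨x, hNK hxN⟩ ∈ LinearMap.range p ⊓ D := ⟨⟨_, rfl⟩, hxD⟩
      rw [hD, Submodule.mem_bot] at this
      have := hp (this.trans (map_zero p).symm)
      simpa using congrArg Subtype.val this
    rw [eq_bot_iff]
    intro y hy
    obtain ⟨x, rfl⟩ := C.mkQ_surjective y
    have : x ∈ D.comap C.mkQ := hy
    rw [h1] at this
    simpa using this
  obtain ⟨g, hg⟩ := hE.out p hp K.subtype
  have hginj : Function.Injective g :=
    injective_of_injective_comp hpess fun x hx => by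
      rw [hg] at hx
      have : x = 0 := by simpa using hx
      simp [this]
  have hrange : LinearMap.range g = K := by
    apply hKmax
    · intro x hx
      exact ⟨p ⟨x, hx⟩, hg _⟩
    · have h1 : (C.comap g) = ⊥ := by
        apply hpess
        rw [eq_bot_iff]
        rintro _ ⟨⟨x, rfl⟩, hx⟩
        have hx' : (x : E) ∈ C := by simpa [hg] using hx
        have : (x : E) ∈ K ⊓ C := ⟨x.2, hx'⟩
        rw [hKC] at this
        have : x = 0 := by simpa using this
        simp [this]
      rw [eq_bot_iff]
      rintro _ ⟨⟨x, rfl⟩, hx⟩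
      have : x ∈ C.comap g := hx
      rw [h1, Submodule.mem_bot] at this
      simp [this]
  have hgK : ∀ x, g x ∈ K := fun x => hrange ▸ ⟨x, rfl⟩
  refine ⟨K, hNK, injective_of_retract hE K.subtype (g.codRestrict K hgK ∘ₗ C.mkQ) ?_, hess⟩
  intro x
  ext
  exact hg x

lemma exists_injectiveHull (M : Type u) [AddCommGroup M] [Module A M] :
    ∃ (E : ModuleCat.{u} A) (ι : M →ₗ[A] E), Function.Injective ι ∧ Module.Injective A E ∧
      IsEssential (LinearMap.range ι) := by
  have : CategoryTheory.EnoughInjectives (ModuleCat.{u} A) := ModuleCat.enoughInjectives.{u} A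
  obtain ⟨⟨J, hJ, f, hf⟩⟩ := CategoryTheory.EnoughInjectives.presentation (ModuleCat.of A M)
  have hJ' : Module.Injective A J := (Module.injective_iff_injective_object A J).2 hJ
  have hf' : Function.Injective f.hom := (ModuleCat.mono_iff_injective f).1 hf
  obtain ⟨K, hNK, hK, hess⟩ := exists_injective_essential_le hJ' (LinearMap.range f.hom)
  refine ⟨ModuleCat.of A K, f.hom.codRestrict K fun x => hNK ⟨x, rfl⟩, ?_, hK, ?_⟩
  · intro x y hxy
    exact hf' (congrArg Subtype.val hxy)
  · intro D hD
    have h1 : Submodule.map K.subtype D = ⊥ := by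
      apply hess _ (Submodule.map_subtype_le K D)
      rw [eq_bot_iff]
      rintro _ ⟨⟨x, rfl⟩, ⟨d, hd, hdx⟩⟩
      have : d ∈ LinearMap.range (f.hom.codRestrict K fun x => hNK ⟨x, rfl⟩) ⊓ D :=
        ⟨⟨x, Subtype.ext hdx.symm⟩, hd⟩
      rw [hD, Submodule.mem_bot] at this
      rw [← hdx, this]
      simp
    rw [eq_bot_iff]
    intro d hd
    have h2 : K.subtype d ∈ Submodule.map K.subtype D := ⟨d, hd, rfl⟩
    rw [h1, Submodule.mem_bot] at h2
    exact Subtype.ext h2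

variable (A) in
/-- An injective envelope of a module. -/
structure InjectiveHull (M : Type u) [AddCommGroup M] [Module A M] where
  /-- the envelope -/
  obj : ModuleCat.{u} A
  /-- the embedding into the envelope -/
  ι : M →ₗ[A] obj
  injective_ι : Function.Injective ι
  injective_obj : Module.Injective A obj
  essential : IsEssential (LinearMap.range ι)

variable (A) in
/-- A choice of injective envelope. -/
noncomputable def injectiveHull (M : Type u) [AddCommGroup M] [Module A M] : InjectiveHull A M :=
  Classical.choice (by
    obtain ⟨E, ι, h1, h2, h3⟩ := exists_injectiveHull (A := A) M
    exact ⟨⟨E, ι, h1, h2, h3⟩⟩)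

variable (A) in
/-- The map from an injective envelope to the injective envelope of its cokernel. -/
noncomputable def hullDifferential (M : Type u) [AddCommGroup M] [Module A M] :
    (injectiveHull A M).obj →ₗ[A]
      (injectiveHull A ((injectiveHull A M).obj ⧸ LinearMap.range (injectiveHull A M).ι)).obj :=
  (injectiveHull A _).ι ∘ₗ (LinearMap.range (injectiveHull A M).ι).mkQ

lemma exact_hullDifferential (M : Type u) [AddCommGroup M] [Module A M] :
    Function.Exact (injectiveHull A M).ι (hullDifferential A M) := by
  rw [LinearMap.exact_iff, hullDifferential, LinearMap.ker_comp_of_ker_eq_bot _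
    (LinearMap.ker_eq_bot.2 (injectiveHull A _).injective_ι), Submodule.ker_mkQ]

lemma range_hullDifferential (M : Type u) [AddCommGroup M] [Module A M] :
    LinearMap.range (hullDifferential A M) = LinearMap.range (injectiveHull A
      ((injectiveHull A M).obj ⧸ LinearMap.range (injectiveHull A M).ι)).ι := by
  rw [hullDifferential, LinearMap.range_comp_of_range_eq_top _ (Submodule.range_mkQ _)]

variable (A) in
/-- The iterated cosyzygies of a module. -/
noncomputable def cosyzygy (M : Type u) [AddCommGroup M] [Module A M] : ℕ → ModuleCat.{u} A
  | 0 => ModuleCat.of A M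
  | k + 1 => ModuleCat.of A ((injectiveHull A (cosyzygy M k)).obj ⧸
      LinearMap.range (injectiveHull A (cosyzygy M k)).ι)

variable (A) in
/-- A minimal injective resolution built from injective envelopes. -/
noncomputable def minimalInjectiveResolution (M : Type u) [AddCommGroup M] [Module A M] :
    MinimalInjectiveResolution A M where
  obj k := (injectiveHull A (cosyzygy A M k)).obj
  ι := (injectiveHull A M).ι
  d k := hullDifferential A (cosyzygy A M k)
  injective_obj k := (injectiveHull A (cosyzygy A M k)).injective_obj
  injective_ι := (injectiveHull A M).injective_ι
  exact_zero := exact_hullDifferential M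
  exact_succ k y := (exact_hullDifferential (cosyzygy A M (k + 1)) y).trans
    (SetLike.ext_iff.1 (range_hullDifferential (cosyzygy A M k)).symm y)
  essential_zero := (injectiveHull A M).essential
  essential_succ k D hD := (injectiveHull A (cosyzygy A M (k + 1))).essential D
    ((congrArg (· ⊓ D) (range_hullDifferential (cosyzygy A M k))).symm.trans hD)

lemma projective_of_injective_of_embedding {E Q : Type u} [AddCommGroup E] [Module A E]
    [AddCommGroup Q] [Module A Q] (hE : Module.Injective A E) {φ : E →ₗ[A] Q}
    (hφ : Function.Injective φ) (hQ : Module.Projective A Q) : Module.Projective A E := by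
  obtain ⟨r, hr⟩ := hE.out φ hφ LinearMap.id
  exact Module.Projective.of_split φ r (LinearMap.ext hr)

/-- A supremum above 1 has a member above 1, so a single resolution witnesses both terms and
uniqueness of resolutions is not needed. -/
lemma two_le_dominantDimension_iff (M : Type u) [AddCommGroup M] [Module A M] :
    2 ≤ dominantDimension A M ↔ ∃ I : MinimalInjectiveResolution A M,
      Module.Projective A (I.obj 0) ∧ Module.Projective A (I.obj 1) := by
  constructor
  · intro h
    obtain ⟨k, ⟨I, hI⟩, hk⟩ := lt_sSup_iff.1 (show (1 : ℕ∞) < dominantDimension A M from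
      lt_of_lt_of_le (by norm_num) h)
    exact ⟨I, hI 0 (by simpa using zero_lt_one.trans hk), hI 1 (by simpa using hk)⟩
  · rintro ⟨I, h0, h1⟩
    apply le_sSup
    refine ⟨I, fun i hi => ?_⟩
    have : i < 2 := by exact_mod_cast hi
    interval_cases i
    exacts [h0, h1]

/-- A copresentation by projective injective modules forces dominant dimension at least two. -/
lemma two_le_dominantDimension_of_exact {M Q₀ Q₁ : Type u} [AddCommGroup M] [Module A M]
    [AddCommGroup Q₀] [Module A Q₀] [AddCommGroup Q₁] [Module A Q₁]
    (hi₀ : Module.Injective A Q₀) (hp₀ : Module.Projective A Q₀)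
    (hi₁ : Module.Injective A Q₁) (hp₁ : Module.Projective A Q₁)
    (f : M →ₗ[A] Q₀) (δ : Q₀ →ₗ[A] Q₁) (hf : Function.Injective f) (hδ : Function.Exact f δ) :
    2 ≤ dominantDimension A M := by
  rw [two_le_dominantDimension_iff]
  let I := minimalInjectiveResolution A M
  obtain ⟨φ, hφ⟩ := hi₀.out I.ι I.injective_ι f
  have hφinj : Function.Injective φ := injective_of_injective_comp I.essential_zero fun x hx => by
    rw [hφ] at hx
    rw [hf (hx.trans (map_zero f).symm), map_zero]
  have hker : ∀ y, δ (φ y) = 0 ↔ I.d 0 y = 0 := by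
    intro y
    rw [hδ, I.exact_zero]
    constructor
    · rintro ⟨x, hx⟩
      exact ⟨x, hφinj (by rw [hφ, hx])⟩
    · rintro ⟨x, rfl⟩
      exact ⟨x, (hφ x).symm⟩
  -- The cokernel of M → I₀ lies essentially in I₁ via `p` and embeds in Q₁ via `q`, so any
  -- extension of `q` along `p` embeds I₁ in Q₁.
  let p := (LinearMap.ker (I.d 0)).liftQ (I.d 0) le_rfl
  have hpinj : Function.Injective p := by
    rw [← LinearMap.ker_eq_bot, Submodule.ker_liftQ_eq_bot _ _ _ le_rfl]
  let q := (LinearMap.ker (I.d 0)).liftQ (δ ∘ₗ φ) (fun y hy => (hker y).2 hy)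
  have hpr : LinearMap.range p = LinearMap.range (I.d 0) := Submodule.range_liftQ _ _ _
  obtain ⟨ψ, hψ⟩ := hi₁.out p hpinj q
  have hψinj : Function.Injective ψ := injective_of_injective_comp (ι := p)
      (by rw [hpr]; exact I.essential_succ 0) fun x hx => by
    rw [hψ] at hx
    obtain ⟨y, rfl⟩ := Submodule.mkQ_surjective _ x
    exact (hker y).1 hx
  exact ⟨I, projective_of_injective_of_embedding (I.injective_obj 0) hφinj hp₀,
    projective_of_injective_of_embedding (I.injective_obj 1) hψinj hp₁⟩

end InjectiveHulls

/-! ### Uniserial left ideals generated by idempotents. -/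

section Uniserial

variable {A : Type u} [Ring A]

lemma IsUniserial.smul_or_smul {M : Type v} [AddCommGroup M] [Module A M] (h : IsUniserial A M)
    (y z : M) : (∃ r : A, y = r • z) ∨ ∃ r : A, z = r • y := by
  rcases h (Submodule.span A {y}) (Submodule.span A {z}) with h | h
  · obtain ⟨r, hr⟩ := Submodule.mem_span_singleton.1 (h (Submodule.mem_span_singleton_self y))
    exact .inl ⟨r, hr.symm⟩
  · obtain ⟨r, hr⟩ := Submodule.mem_span_singleton.1 (h (Submodule.mem_span_singleton_self z))
    exact .inr ⟨r, hr.symm⟩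

lemma mem_span_idempotent_iff {e y : A} (he : e * e = e) :
    y ∈ Submodule.span A {e} ↔ y * e = y := by
  rw [Submodule.mem_span_singleton]
  constructor
  · rintro ⟨r, rfl⟩
    rw [smul_eq_mul, mul_assoc, he]
  · exact fun h => ⟨y, h⟩

/-- Right multiplication by `z` as a map `A e → A f`. -/
def rightMul (e : A) {f z : A} (hz : z ∈ Submodule.span A {f}) :
    Submodule.span A {e} →ₗ[A] Submodule.span A {f} :=
  ((LinearMap.toSpanSingleton A A z).codRestrict (Submodule.span A {f})
    fun a => Submodule.smul_mem _ a hz) ∘ₗ (Submodule.span A {e}).subtype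

@[simp] lemma coe_rightMul (e : A) {f z : A} (hz : z ∈ Submodule.span A {f})
    (y : Submodule.span A {e}) : (rightMul e hz y : A) = y * z := rfl

lemma projective_span_idempotent {e : A} (he : e * e = e) :
    Module.Projective A (Submodule.span A {e}) :=
  Module.Projective.of_split (Submodule.span A {e}).subtype
    ((LinearMap.toSpanSingleton A A e).codRestrict (Submodule.span A {e})
    fun a => Submodule.smul_mem _ a (Submodule.mem_span_singleton_self e))
    (LinearMap.ext fun y => Subtype.ext ((mem_span_idempotent_iff he).1 y.2))

/-- Nakayama's lemma for the cyclic module A w. -/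
lemma eq_zero_of_eq_mul {j w : A} (hj : j ∈ Ring.jacobson A) (h : w = j * w) : w = 0 := by
  have h1 : Submodule.span A {w} = ⊥ := by
    apply (Submodule.fg_span_singleton w).eq_bot_of_le_jacobson_smul
    rw [Submodule.span_singleton_le_iff_mem]
    nth_rewrite 2 [h]
    exact Submodule.smul_mem_smul hj (Submodule.mem_span_singleton_self w)
  exact Submodule.span_singleton_eq_bot.1 h1

lemma mul_mem_jacobson_right {j : A} (hj : j ∈ Ring.jacobson A) (a : A) :
    j * a ∈ Ring.jacobson A := Ideal.mul_mem_right a _ hj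

lemma mul_mem_jacobson_left {j : A} (hj : j ∈ Ring.jacobson A) (a : A) :
    a * j ∈ Ring.jacobson A := Ideal.mul_mem_left _ a hj

lemma not_mem_jacobson {e : A} (he : e * e = e) (h0 : e ≠ 0) : e ∉ Ring.jacobson A :=
  fun h => h0 (eq_zero_of_eq_mul h he.symm)

/-- Elementwise uniseriality of the left ideal `A e`. -/
def UniserialAt (e : A) : Prop :=
  ∀ y z : A, y * e = y → z * e = z → (∃ r, y = r * z) ∨ ∃ r, z = r * y

/-- Some maximal left ideal m misses r, so 1 = k + s r with k ∈ m. Compare r with e k in the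
uniserial module A e: r ∈ A e k would put r in m, hence e k ∈ A r and e ∈ A r. -/
lemma UniserialAt.exists_mul_eq {e r : A} (h : UniserialAt e) (he : e * e = e)
    (hr : r * e = r) (hrJ : r ∉ Ring.jacobson A) : ∃ s, s * r = e ∧ e * s = s := by
  suffices ∃ s, s * r = e by
    obtain ⟨s, hs⟩ := this
    exact ⟨e * s, by rw [mul_assoc, hs, he], by rw [← mul_assoc, he]⟩
  rw [Ring.jacobson_eq_sInf_isMaximal, Submodule.mem_sInf] at hrJ
  push Not at hrJ
  obtain ⟨m, hm, hrm⟩ := hrJ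
  have h1 : (1 : A) ∈ m ⊔ Submodule.span A {r} := by
    rw [(Ideal.isMaximal_def.1 hm).2 _ (left_lt_sup.2 fun h =>
      hrm (h (Submodule.mem_span_singleton_self r)))]
    trivial
  obtain ⟨k, hk, l, hl, hkl⟩ := Submodule.mem_sup.1 h1
  obtain ⟨s, rfl⟩ := Submodule.mem_span_singleton.1 hl
  rw [smul_eq_mul] at hkl
  have hek : e * k = e - e * (s * r) := eq_sub_of_add_eq (by rw [← mul_add, hkl, mul_one])
  have hek' : (e * k) * e = e * k := by
    rw [hek, sub_mul, he, mul_assoc, mul_assoc, hr]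
  rcases h r (e * k) hr hek' with ⟨t, ht⟩ | ⟨t, ht⟩
  · exact absurd (ht ▸ m.smul_mem t (m.smul_mem e hk) : r ∈ m) hrm
  · refine ⟨t + e * s, ?_⟩
    rw [add_mul, ← ht, hek]
    noncomm_ring

/-- An element of `e A f` outside the radical is invertible when `A e` and `A f` are uniserial. -/
lemma UniserialAt.exists_inverse {e f y : A} (hUe : UniserialAt e) (hUf : UniserialAt f)
    (he : e * e = e) (hf : f * f = f) (hf0 : f ≠ 0)
    (hey : e * y = y) (hyf : y * f = y) (hyJ : y ∉ Ring.jacobson A) :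
    ∃ s, s * y = f ∧ y * s = e ∧ f * s = s ∧ s * e = s := by
  obtain ⟨s, hs, hfs⟩ := hUf.exists_mul_eq hf hyf hyJ
  have h1 : (s * e) * y = f := by rw [mul_assoc, hey, hs]
  have h2 : f * (s * e) = s * e := by rw [← mul_assoc, hfs]
  have h3 : (s * e) * e = s * e := by rw [mul_assoc, he]
  have h4 : s * e ∉ Ring.jacobson A := fun h =>
    not_mem_jacobson hf hf0 (h1 ▸ mul_mem_jacobson_right h y)
  obtain ⟨t, ht, het⟩ := hUe.exists_mul_eq he h3 h4
  refine ⟨s * e, h1, ?_, h2, h3⟩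
  have : t * f = y := by rw [← h1, ← mul_assoc, ht, hey]
  rw [← this, mul_assoc, h2, ht]

end Uniserial

/-! ### Paths, their left ideals and socles. -/

section PathSystem

/-- A family of idempotents `e a` and arrows `x a` from `a + 1` to `a` such that the modules `A e_a`
are uniserial and `A x_a` is the radical of `A e_{a+1}`; vertices from `n` on are zero. -/
structure IsPathSystem {A : Type u} [Ring A] (n : ℕ) (e x : ℕ → A) : Prop where
  idem : ∀ a, e a * e a = e a
  ortho : ∀ a b, a ≠ b → e a * e b = 0
  sum_eq_one : ∑ i ∈ Finset.range n, e i = 1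
  ne_zero : ∀ a < n, e a ≠ 0
  eq_zero : ∀ a, n ≤ a → e a = 0
  uniserial : ∀ a, UniserialAt (e a)
  mem_jacobson : ∀ a b y, a ≠ b → e a * y = y → y * e b = y → y ∈ Ring.jacobson A
  e_mul_x : ∀ a, e a * x a = x a
  x_mul_e : ∀ a, x a * e (a + 1) = x a
  x_mem : ∀ a, x a ∈ Ring.jacobson A
  exists_eq_mul_x : ∀ a y, y ∈ Ring.jacobson A → y * e (a + 1) = y → ∃ r, y = r * x a
  radical_zero : ∀ y, y ∈ Ring.jacobson A → y * e 0 = 0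

variable {A : Type u} [Ring A] {n : ℕ} {e x : ℕ → A}

/-- The path of length `m` ending in `a`. -/
def path (e x : ℕ → A) (a : ℕ) : ℕ → A
  | 0 => e a
  | m + 1 => path e x a m * x (a + m)

/-- Right multiplication by `x i` is injective on `A e_i`. -/
def ArrowInjective (e x : ℕ → A) (i : ℕ) : Prop := ∀ r, r * e i = r → r * x i = 0 → r = 0

/-- A path that generates a simple left ideal. -/
def IsSoclePath (e x : ℕ → A) (a m : ℕ) : Prop :=
  path e x a m ≠ 0 ∧ ∀ j ∈ Ring.jacobson A, j * path e x a m = 0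

namespace IsPathSystem

variable (h : IsPathSystem n e x)
include h

lemma e_mul_path (a m : ℕ) : e a * path e x a m = path e x a m := by
  induction m with
  | zero => exact h.idem a
  | succ m ih => rw [path, ← mul_assoc, ih]

lemma path_mul_e (a m : ℕ) : path e x a m * e (a + m) = path e x a m := by
  cases m with
  | zero => exact h.idem a
  | succ m => rw [path, mul_assoc, ← add_assoc, h.x_mul_e]

lemma path_succ (a m : ℕ) : path e x a (m + 1) = x a * path e x (a + 1) m := by
  induction m with
  | zero => simp [path, h.e_mul_x, h.x_mul_e]
  | succ m ih => rw [path, ih, path, mul_assoc, add_right_comm, add_assoc]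

lemma path_add (a m k : ℕ) : path e x a (m + k) = path e x a m * path e x (a + m) k := by
  induction k with
  | zero => rw [path, h.path_mul_e, add_zero]
  | succ k ih => rw [← add_assoc, path, ih, path, mul_assoc, add_assoc]

lemma lt_of_path_ne_zero {a m : ℕ} (hp : path e x a m ≠ 0) : a + m < n := by
  by_contra hlt
  exact hp (by rw [← h.path_mul_e, h.eq_zero _ (by omega), mul_zero])

/-- Every nonzero element of `A e_b` generates the same left ideal as a path. -/
lemma exists_path_eq (b : ℕ) : ∀ y : A, y * e b = y → y ≠ 0 →
    ∃ a m, a + m = b ∧ (∃ r, y = r * path e x a m) ∧ ∃ s, path e x a m = s * y := by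
  have key : ∀ b y, y * e b = y → y ∉ Ring.jacobson A →
      ∃ a m, a + m = b ∧ (∃ r, y = r * path e x a m) ∧ ∃ s, path e x a m = s * y := by
    intro b y hy hyJ
    obtain ⟨s, hs, -⟩ := (h.uniserial b).exists_mul_eq (h.idem b) hy hyJ
    exact ⟨b, 0, rfl, ⟨y, hy.symm⟩, s, hs.symm⟩
  induction b with
  | zero =>
    intro y hy hy0
    exact key 0 y hy fun hJ => hy0 (by rw [← hy, h.radical_zero y hJ])
  | succ b ih =>
    intro y hy hy0
    by_cases hyJ : y ∈ Ring.jacobson A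
    -- A radical element comes from A e_b through x_b; a path for its preimage gets one more arrow
    -- on the right.
    · obtain ⟨r, rfl⟩ := h.exists_eq_mul_x b y hyJ hy
      have hr : (r * e b) * x b = r * x b := by rw [mul_assoc, h.e_mul_x]
      obtain ⟨a, m, hab, ⟨t, ht⟩, s, hs⟩ := ih (r * e b) (by rw [mul_assoc, h.idem])
        (fun h0 => hy0 (by rw [← hr, h0, zero_mul]))
      refine ⟨a, m + 1, by omega, ⟨t, ?_⟩, s, ?_⟩
      · rw [path, ← mul_assoc, ← ht, hab, hr]
      · rw [path, hs, hab, mul_assoc, hr]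
    · exact key _ y hy hyJ

/-- Two-sided refinement of `exists_path_eq`: the path ends in the given vertex a, and both factors
lie in e_a A e_a. -/
lemma exists_path_eq_of_mem {a b : ℕ} {y : A} (hay : e a * y = y) (hyb : y * e b = y)
    (hy : y ≠ 0) : ∃ m, a + m = b ∧ ∃ t s, y = t * path e x a m ∧ path e x a m = s * y ∧
      e a * t = t ∧ t * e a = t ∧ e a * s = s ∧ s * e a = s := by
  obtain ⟨a', m, hab, ⟨r, hr⟩, s, hs⟩ := h.exists_path_eq b y hyb hy
  have h1 : y = (e a * r * e a') * path e x a' m := by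
    rw [mul_assoc, h.e_mul_path, mul_assoc, ← hr, hay]
  have h2 : path e x a' m = (e a' * s * e a) * y := by
    rw [mul_assoc, hay, mul_assoc, ← hs, h.e_mul_path]
  obtain rfl : a = a' := by
    by_contra hne
    -- For a ≠ a' this factor is radical, so the path would be a radical multiple of itself and
    -- vanish.
    have hJ : e a * r * e a' ∈ Ring.jacobson A := h.mem_jacobson a a' _ hne
      (by rw [← mul_assoc, ← mul_assoc, h.idem]) (by rw [mul_assoc, h.idem])
    have h0 := eq_zero_of_eq_mul (w := path e x a' m)
      (mul_mem_jacobson_left hJ (e a' * s * e a))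
      (by rw [mul_assoc (e a' * s * e a), ← h1, ← h2])
    exact hy (by rw [hr, h0, mul_zero])
  refine ⟨m, hab, _, _, h1, h2, ?_, ?_, ?_, ?_⟩ <;> simp only [mul_assoc, h.idem] <;>
    simp only [← mul_assoc, h.idem]

/-- Prepend arrows while the path stays nonzero. When x_a kills it, so does the whole radical,
because rad e_{a+1} = A x_a; at vertex 0 the radical acts as zero. -/
lemma exists_isSoclePath : ∀ a m, path e x a m ≠ 0 →
    ∃ a' m', a' + m' = a + m ∧ IsSoclePath e x a' m' := by
  intro a
  induction a with
  | zero =>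
    intro m hm
    refine ⟨0, m, rfl, hm, fun j hj => ?_⟩
    rw [← h.e_mul_path, ← mul_assoc, h.radical_zero j hj, zero_mul]
  | succ a ih =>
    intro m hm
    by_cases h0 : path e x a (m + 1) = 0
    · refine ⟨a + 1, m, rfl, hm, fun j hj => ?_⟩
      obtain ⟨r, hr⟩ := h.exists_eq_mul_x a (j * e (a + 1)) (mul_mem_jacobson_right hj _)
        (by rw [mul_assoc, h.idem])
      rw [← h.e_mul_path, ← mul_assoc, hr, mul_assoc, ← h.path_succ, h0, mul_zero]
    · obtain ⟨a', m', h1, h2⟩ := ih (m + 1) h0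
      exact ⟨a', m', by omega, h2⟩

/-- The socle of `A e_b` lies in every nonzero submodule. -/
lemma exists_soclePath_eq_mul {a m : ℕ} (hs : IsSoclePath e x a m) {y : A}
    (hy : y * e (a + m) = y) (hy0 : y ≠ 0) : ∃ s, path e x a m = s * y := by
  rcases h.uniserial (a + m) _ _ (h.path_mul_e a m) hy with hc | ⟨t, ht⟩
  · exact hc
  · have h1 : (t * e a) * path e x a m = y := by rw [mul_assoc, h.e_mul_path, ← ht]
    have hJ : t * e a ∉ Ring.jacobson A := fun hJ => hy0 (by rw [← h1, hs.2 _ hJ])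
    obtain ⟨s, hst, -⟩ := (h.uniserial a).exists_mul_eq (h.idem a)
      (by rw [mul_assoc, h.idem]) hJ
    exact ⟨s, by rw [← h1, ← mul_assoc, hst, h.e_mul_path]⟩

lemma isSoclePath_add {a m k : ℕ} (hs : IsSoclePath e x a m)
    (hk : ∀ r, r * e (a + m) = r → r * path e x (a + m) k = 0 → r = 0) :
    IsSoclePath e x a (m + k) := by
  constructor
  · rw [h.path_add]
    exact fun h0 => hs.1 (hk _ (h.path_mul_e a m) h0)
  · intro j hj
    rw [h.path_add, ← mul_assoc, hs.2 j hj, zero_mul]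

lemma not_arrowInjective_of_le {i : ℕ} (hi : i < n) (hn : n ≤ i + 1) :
    ¬ ArrowInjective e x i := fun hinj =>
  h.ne_zero i hi (hinj _ (h.idem i) (by rw [← h.x_mul_e, h.eq_zero _ hn, mul_zero, mul_zero]))

/-- Every vertex is the end of a path, injective under right multiplication, from a vertex whose
outgoing arrow is not injective. -/
lemma exists_injective_path : ∀ d i, i + d + 1 = n → ∃ m, i + m < n ∧
    ¬ ArrowInjective e x (i + m) ∧ ∀ r, r * e i = r → r * path e x i m = 0 → r = 0 := by
  intro d
  induction d with
  | zero =>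
    intro i hi
    refine ⟨0, by omega, h.not_arrowInjective_of_le (by omega) (by omega), fun r hr h0 => ?_⟩
    rwa [path, hr] at h0
  | succ d ih =>
    intro i hi
    by_cases hinj : ArrowInjective e x i
    · obtain ⟨m, h1, h2, h3⟩ := ih (i + 1) (by omega)
      refine ⟨m + 1, by omega, by rwa [← add_assoc, add_right_comm], fun r hr h0 => ?_⟩
      rw [h.path_succ, ← mul_assoc] at h0
      exact hinj r hr (h3 _ (by rw [mul_assoc, h.x_mul_e]) h0)
    · exact ⟨0, by omega, hinj, fun r hr h0 => by rwa [path, hr] at h0⟩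

end IsPathSystem
end PathSystem

/-! ### Lengths of the indecomposable projectives. -/

section Lengths

variable {A : Type u} [Ring A]

lemma length_eq_add_one_of_covBy {M : Type*} [AddCommGroup M] [Module A M] {N K : Submodule A M}
    (hNK : N ⋖ K) : Module.length A K = Module.length A N + 1 := by
  have hs : IsSimpleModule A (K ⧸ N.comap K.subtype) := (covBy_iff_quot_is_simple hNK.le).1 hNK
  rw [Module.length_eq_add_of_exact (N.comap K.subtype).subtype (N.comap K.subtype).mkQ
    (Submodule.subtype_injective _) (Submodule.mkQ_surjective _)
    (LinearMap.exact_subtype_mkQ _), Module.length_eq_one A (K ⧸ N.comap K.subtype),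
    (Submodule.comapSubtypeEquivOfLe hNK.le).length_eq]

variable {n : ℕ} {e x : ℕ → A}

namespace IsPathSystem

variable (h : IsPathSystem n e x)
include h

/-- A y is covered by A z: an element r z outside A y has r e_a outside the radical by `hJ`, so r z
generates z. -/
lemma length_span_eq_add_one {a : ℕ} {y z : A} (hz : e a * z = z) (hz0 : z ≠ 0)
    (hy : ∃ j ∈ Ring.jacobson A, y = j * z)
    (hJ : ∀ j ∈ Ring.jacobson A, j * e a = j → ∃ r, j * z = r * y) :
    Module.length A (Submodule.span A {z}) = Module.length A (Submodule.span A {y}) + 1 := by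
  apply length_eq_add_one_of_covBy
  obtain ⟨j, hj, rfl⟩ := hy
  have hle : Submodule.span A {j * z} ≤ Submodule.span A {z} := by
    rw [Submodule.span_singleton_le_iff_mem]
    exact Submodule.smul_mem _ j (Submodule.mem_span_singleton_self z)
  have hne : z ∉ Submodule.span A {j * z} := by
    intro hmem
    obtain ⟨r, hr⟩ := Submodule.mem_span_singleton.1 hmem
    exact hz0 (eq_zero_of_eq_mul (mul_mem_jacobson_left hj r) (by
      rw [mul_assoc]; exact hr.symm))
  refine ⟨lt_of_le_of_ne hle fun heq => hne (heq ▸ Submodule.mem_span_singleton_self z), ?_⟩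
  intro D hD hDz
  obtain ⟨w, hwD, hw⟩ := SetLike.exists_of_lt hD
  obtain ⟨r, rfl⟩ := Submodule.mem_span_singleton.1 (hDz.le hwD)
  have hrz : (r * e a) * z = r * z := by rw [mul_assoc, hz]
  have hrJ : r * e a ∉ Ring.jacobson A := by
    intro hmem
    obtain ⟨t, ht⟩ := hJ _ hmem (by rw [mul_assoc, h.idem])
    exact hw (Submodule.mem_span_singleton.2 ⟨t, by rw [smul_eq_mul, smul_eq_mul, ← ht, hrz]⟩)
  obtain ⟨s, hs, -⟩ := (h.uniserial a).exists_mul_eq (h.idem a) (by rw [mul_assoc, h.idem]) hrJ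
  refine hDz.not_ge ?_
  rw [Submodule.span_singleton_le_iff_mem]
  have : s • (r • z) = z := by
    rw [smul_eq_mul, smul_eq_mul, ← hrz, ← mul_assoc, hs, hz]
  exact this ▸ D.smul_mem s hwD

lemma length_span_path {a m : ℕ} (hp : path e x (a + 1) m ≠ 0) :
    Module.length A (Submodule.span A {path e x (a + 1) m}) =
      Module.length A (Submodule.span A {path e x a (m + 1)}) + 1 := by
  refine h.length_span_eq_add_one (h.e_mul_path _ m) hp ⟨x a, h.x_mem a, h.path_succ a m⟩ ?_
  intro j hj hja
  obtain ⟨r, hr⟩ := h.exists_eq_mul_x a j hj hja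
  exact ⟨r, by rw [hr, mul_assoc, ← h.path_succ]⟩

lemma length_span_idem {m : ℕ} : ∀ a, path e x a m ≠ 0 →
    Module.length A (Submodule.span A {e (a + m)}) =
      m + Module.length A (Submodule.span A {path e x a m}) := by
  induction m with
  | zero => intro a _; exact (zero_add _).symm
  | succ m ih =>
    intro a hp
    have hp' : path e x (a + 1) m ≠ 0 := fun h0 => hp (by rw [h.path_succ, h0, mul_zero])
    rw [← add_assoc, add_right_comm, ih (a + 1) hp', h.length_span_path hp']
    push_cast
    ring

lemma length_of_isSoclePath {a m : ℕ} (hs : IsSoclePath e x a m) :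
    Module.length A (Submodule.span A {e (a + m)}) = m + 1 := by
  rw [h.length_span_idem a hs.1, h.length_span_eq_add_one (y := 0) (h.e_mul_path a m) hs.1
    ⟨0, zero_mem _, by simp⟩ fun j hj _ => ⟨0, by rw [hs.2 j hj, zero_mul]⟩,
    Submodule.span_zero_singleton, Module.length_bot, zero_add]

lemma exists_isSoclePath_vertex {b : ℕ} (hb : b < n) : ∃ a m, a + m = b ∧ IsSoclePath e x a m :=
  h.exists_isSoclePath b 0 (h.ne_zero b hb)

lemma length_zero_vertex (hn : 0 < n) : Module.length A (Submodule.span A {e 0}) = 1 := by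
  obtain ⟨a, m, hab, hs⟩ := h.exists_isSoclePath_vertex hn
  obtain ⟨rfl, rfl⟩ : a = 0 ∧ m = 0 := by omega
  simpa using h.length_of_isSoclePath hs

lemma length_succ_of_arrowInjective {i : ℕ} (hi : i < n) (hinj : ArrowInjective e x i) :
    Module.length A (Submodule.span A {e (i + 1)}) =
      Module.length A (Submodule.span A {e i}) + 1 := by
  obtain ⟨a, m, rfl, hs⟩ := h.exists_isSoclePath_vertex hi
  have hs' : IsSoclePath e x a (m + 1) := h.isSoclePath_add hs fun r hr h0 =>
    hinj r hr (by rwa [path, path, ← mul_assoc, add_zero, hr] at h0)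
  rw [h.length_of_isSoclePath hs, add_assoc, h.length_of_isSoclePath hs']
  push_cast
  rfl

/-- Let the socle of P_{i+1} be generated by the path from i + 1 to a. If P_{i+1} is not simple,
dropping the first arrow leaves a path that survives right multiplication by x_i, so it cannot
generate the socle of P_i, which the nonzero kernel contains. Hence P_i has a composition factor
below a and is at least as long. -/
lemma length_succ_le_of_not_arrowInjective {i : ℕ} (hi : i + 1 < n)
    (hinj : ¬ ArrowInjective e x i) :
    Module.length A (Submodule.span A {e (i + 1)}) ≤
      Module.length A (Submodule.span A {e i}) := by
  obtain ⟨a, m, hab, hs⟩ := h.exists_isSoclePath_vertex hi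
  have hpos : ∀ z : A, z ≠ 0 → 1 ≤ Module.length A (Submodule.span A {z}) := by
    intro z hz
    rw [Order.one_le_iff_pos, Module.length_pos_iff, Submodule.nontrivial_iff_ne_bot]
    exact fun h0 => hz (Submodule.span_singleton_eq_bot.1 h0)
  rw [← hab, h.length_of_isSoclePath hs]
  cases m with
  | zero => simpa using hpos _ (h.ne_zero i (by omega))
  | succ m =>
    obtain rfl : a + m = i := by omega
    have hp : path e x a m ≠ 0 := fun h0 => hs.1 (by rw [path, h0, zero_mul])
    have hns : ¬ IsSoclePath e x a m := by
      intro hs'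
      apply hinj
      intro r hr hrx
      by_contra hr0
      obtain ⟨s, hsr⟩ := h.exists_soclePath_eq_mul hs' hr hr0
      exact hs.1 (by rw [path, hsr, mul_assoc, hrx, mul_zero])
    obtain ⟨j, hj, hj0⟩ : ∃ j ∈ Ring.jacobson A, j * path e x a m ≠ 0 := by
      by_contra hc
      push Not at hc
      exact hns ⟨hp, hc⟩
    cases a with
    | zero =>
      exact absurd (by rw [← h.e_mul_path, ← mul_assoc, h.radical_zero j hj, zero_mul]) hj0
    | succ a =>
      obtain ⟨r, hr⟩ := h.exists_eq_mul_x a (j * e (a + 1)) (mul_mem_jacobson_right hj _)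
        (by rw [mul_assoc, h.idem])
      have hp' : path e x a (m + 1) ≠ 0 := by
        intro h0
        apply hj0
        rw [← h.e_mul_path, ← mul_assoc, hr, mul_assoc, ← h.path_succ, h0, mul_zero]
      rw [h.length_span_idem (a + 1) hp, h.length_span_path hp]
      push_cast
      rw [add_assoc]
      gcongr
      exact hpos _ hp'

end IsPathSystem
end Lengths

/-! ### Which indecomposable projectives are injective. -/

section Injectivity

variable {A : Type u} [Ring A] {n : ℕ} {e x : ℕ → A}

/-- Two complementary submodules of E have comparable traces on M, so one trace is zero and
essentiality kills that summand. Thus E is indecomposable. -/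
lemma isUniserial_of_essential {M E : Type u} [AddCommGroup M] [Module A M]
    [AddCommGroup E] [Module A E] (hA : IsNakayama A) (hE : Module.Injective A E)
    (hM : IsUniserial A M) [Nontrivial M] {φ : M →ₗ[A] E} (hφ : Function.Injective φ)
    (hess : IsEssential (LinearMap.range φ)) : IsUniserial A E := by
  have key : ∀ N N' : Submodule A E, N ⊓ N' = ⊥ → N.comap φ ≤ N'.comap φ → N = ⊥ := by
    intro N N' hd hle
    apply hess
    rw [eq_bot_iff, ← hd]
    rintro _ ⟨⟨y, rfl⟩, hy⟩
    exact ⟨hy, hle hy⟩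
  refine hA.injective E hE ⟨hφ.nontrivial, fun N N' hc => ?_⟩
  rcases hM (N.comap φ) (N'.comap φ) with hle | hle
  · exact .inl (key N N' hc.inf_eq_bot hle)
  · exact .inr (key N' N (by rw [inf_comm, hc.inf_eq_bot]) hle)

namespace IsPathSystem

variable (h : IsPathSystem n e x)
include h

lemma isUniserial_span (i : ℕ) : IsUniserial A (Submodule.span A {e i}) := by
  intro N N'
  by_contra hc
  push Not at hc
  obtain ⟨⟨y, hy, hy'⟩, z, hz, hz'⟩ := SetLike.not_le_iff_exists.1 hc.1,
    SetLike.not_le_iff_exists.1 hc.2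
  rcases h.uniserial i y z ((mem_span_idempotent_iff (h.idem i)).1 y.2)
    ((mem_span_idempotent_iff (h.idem i)).1 z.2) with ⟨r, hr⟩ | ⟨r, hr⟩
  · exact hy' ((Subtype.ext hr : y = r • z) ▸ N'.smul_mem r hz)
  · exact hz' ((Subtype.ext hr : z = r • y) ▸ N.smul_mem r hy)

/-- If the arrow starting the radical of `A e_{i+1}` is not injective on `A e_i`, then `A e_i` is
injective. -/
lemma injective_of_not_arrowInjective (hA : IsNakayama A) {i : ℕ} (hi : i < n)
    (hinj : ¬ ArrowInjective e x i) : Module.Injective A (Submodule.span A {e i}) := by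
  let H := injectiveHull A (Submodule.span A {e i})
  let ε : Submodule.span A {e i} := ⟨e i, Submodule.mem_span_singleton_self _⟩
  have hε : e i • ε = ε := Subtype.ext (h.idem i)
  have hε0 : ε ≠ 0 := fun h0 => h.ne_zero i hi (congrArg Subtype.val h0)
  have : Nontrivial (Submodule.span A {e i}) := ⟨ε, 0, hε0⟩
  have huni := (isUniserial_of_essential hA H.injective_obj (h.isUniserial_span i) H.injective_ι
    H.essential).smul_or_smul
  have hu0 : H.ι ε ≠ 0 := fun h0 => hε0 (H.injective_ι (by rw [h0, map_zero]))
  have hsurj : Function.Surjective H.ι := by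
    by_contra hns
    rw [← LinearMap.range_eq_top] at hns
    obtain ⟨k, y, hky, hy⟩ : ∃ k, ∃ y : H.obj, e k • y = y ∧ y ∉ LinearMap.range H.ι := by
      by_contra hc
      push Not at hc
      apply hns
      rw [eq_top_iff]
      intro y _
      rw [← one_smul A y, ← h.sum_eq_one, Finset.sum_smul]
      exact Submodule.sum_mem _ fun k _ => hc k _ (by rw [smul_smul, h.idem])
    rcases huni y (H.ι ε) with ⟨r, hr⟩ | ⟨r, hr⟩
    · exact hy (hr ▸ ⟨r • ε, map_smul _ _ _⟩)
    -- Up to an invertible factor, e_i r e_k is a path. A trivial path would put y in the image; a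
    -- longer one begins with x_i, so anything killed by x_i on the right kills ι(e_i) up to that
    -- factor, and x_i would be injective.
    have hsy : (e i * r * e k) • y = H.ι ε := by
      rw [mul_smul, hky, mul_smul, ← hr, ← map_smul, hε]
    have hs0 : e i * r * e k ≠ 0 := fun h0 => hu0 (by rw [← hsy, h0, zero_smul])
    obtain ⟨m, hik, t, t', ht, ht', -, -, hit', hti'⟩ := h.exists_path_eq_of_mem (a := i) (b := k)
      (by rw [← mul_assoc, ← mul_assoc, h.idem]) (by rw [mul_assoc, h.idem]) hs0
    have hpy : path e x i m • y = t' • H.ι ε := by rw [ht', mul_smul, hsy]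
    have hp0 : path e x i m ≠ 0 := fun h0 => hs0 (by rw [ht, h0, mul_zero])
    cases m with
    | zero =>
      obtain rfl : i = k := hik
      refine hy ⟨t' • ε, ?_⟩
      rw [map_smul, ← hpy]
      exact hky
    | succ m =>
      apply hinj
      intro r hr hrx
      have h1 : (r * t') • H.ι ε = 0 := by
        rw [mul_smul, ← hpy, smul_smul, h.path_succ, ← mul_assoc, hrx, zero_mul, zero_smul]
      have h2 : r * t' = 0 := by
        rw [← map_smul, ← map_zero H.ι] at h1
        have h3 : r * t' * e i = 0 := congrArg Subtype.val (H.injective_ι h1)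
        rwa [mul_assoc, hti'] at h3
      have ht'J : t' ∉ Ring.jacobson A := fun hJ =>
        hp0 (eq_zero_of_eq_mul (mul_mem_jacobson_right hJ t) (by rw [mul_assoc, ← ht, ← ht']))
      obtain ⟨s, -, hs, -⟩ := (h.uniserial i).exists_inverse (h.uniserial i) (h.idem i) (h.idem i)
        (h.ne_zero i hi) hit' hti' ht'J
      rw [← hr, ← hs, ← mul_assoc, h2, zero_mul]
  let φ := LinearEquiv.ofBijective H.ι ⟨H.injective_ι, hsurj⟩
  exact injective_of_retract H.injective_obj φ.toLinearMap φ.symm.toLinearMap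
    fun y => φ.symm_apply_apply y

end IsPathSystem
end Injectivity

/-! ### Dominant dimension at least two as a condition on socles. -/

section Copresentation

variable {A : Type u} [Ring A] {n : ℕ} {e x : ℕ → A}

/-- For every projective `A e_i` that is not injective, the simple module at `i + 1` is the socle of
a projective injective module. -/
def SocleCondition (n : ℕ) (e x : ℕ → A) : Prop :=
  ∀ i < n, ArrowInjective e x i → ∃ m, i + 1 + m < n ∧ ¬ ArrowInjective e x (i + 1 + m) ∧
    IsSoclePath e x (i + 1) m

lemma projective_pi {ι : Type*} [Finite ι] (M : ι → Type u) [∀ i, AddCommGroup (M i)]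
    [∀ i, Module A (M i)] [∀ i, Module.Projective A (M i)] : Module.Projective A (∀ i, M i) := by
  classical
  have := Fintype.ofFinite ι
  exact Module.Projective.of_equiv' (DFinsupp.linearEquivFunOnFintype (R := A) (M := M))

lemma exists_linearMap_ne_zero {M : Type*} [AddCommGroup M] [Module A M]
    (hM : Module.Projective A M) {z : M} (hz : z ≠ 0) : ∃ l : M →ₗ[A] A, l z ≠ 0 := by
  obtain ⟨s, hs⟩ := hM.out
  have h0 : s z ≠ 0 := fun h0 => hz (by rw [← hs z, h0, map_zero])
  obtain ⟨m, hm⟩ := Finsupp.ne_iff.1 h0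
  exact ⟨Finsupp.lapply m ∘ₗ s, hm⟩

namespace IsPathSystem

variable (h : IsPathSystem n e x)
include h

/-- Extending P_i → I₀ to P_{i+1} gives v ∈ I₀ whose image in I₁ spans a copy of S_{i+1}.
Projectivity of I₁ carries this simple module into A, where it is generated by a path. -/
lemma socleCondition_of_two_le (hd : 2 ≤ dominantDimension A A) : SocleCondition n e x := by
  obtain ⟨I, -, hI⟩ := (two_le_dominantDimension_iff A).1 hd
  intro i hi hinj
  have hx : x i ∈ Submodule.span A {e (i + 1)} :=
    (mem_span_idempotent_iff (h.idem _)).2 (h.x_mul_e i)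
  have hinj' : Function.Injective (rightMul (e i) hx) := by
    rw [injective_iff_map_eq_zero]
    intro y hy
    exact Subtype.ext (hinj y ((mem_span_idempotent_iff (h.idem _)).1 y.2)
      (congrArg Subtype.val hy))
  obtain ⟨g, hg⟩ := (I.injective_obj 0).out (rightMul (e i) hx) hinj'
    (I.ι ∘ₗ (Submodule.span A {e i}).subtype)
  let v := g ⟨e (i + 1), Submodule.mem_span_singleton_self _⟩
  have hxv : x i • v = I.ι (e i) := by
    have := hg ⟨e i, Submodule.mem_span_singleton_self _⟩
    rw [LinearMap.comp_apply, Submodule.subtype_apply] at this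
    rw [← this, ← map_smul]
    congr 1
    exact Subtype.ext ((h.x_mul_e i).trans (h.e_mul_x i).symm)
  have hev : e (i + 1) • v = v := by
    rw [← map_smul]
    congr 1
    exact Subtype.ext (h.idem (i + 1))
  have hxz : x i • I.d 0 v = 0 := by
    rw [← map_smul, hxv]
    exact (I.exact_zero _).2 ⟨_, rfl⟩
  have hJz : ∀ j ∈ Ring.jacobson A, j • I.d 0 v = 0 := by
    intro j hj
    obtain ⟨r, hr⟩ := h.exists_eq_mul_x i (j * e (i + 1)) (mul_mem_jacobson_right hj _)
      (by rw [mul_assoc, h.idem])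
    rw [← hev, map_smul, smul_smul, hr, mul_smul, hxz, smul_zero]
  have hz0 : I.d 0 v ≠ 0 := by
    intro h0
    obtain ⟨y, hy⟩ := (I.exact_zero _).1 h0
    have : x i * y = e i := I.injective_ι (by
      rw [← smul_eq_mul, map_smul, hy, hxv])
    exact not_mem_jacobson (h.idem i) (h.ne_zero i hi)
      (this ▸ mul_mem_jacobson_right (h.x_mem i) y)
  obtain ⟨l, hl⟩ := exists_linearMap_ne_zero hI hz0
  obtain ⟨k, hk⟩ : ∃ k, l (I.d 0 v) * e k ≠ 0 := by
    by_contra hc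
    push Not at hc
    apply hl
    rw [← mul_one (l _), ← h.sum_eq_one, Finset.mul_sum]
    exact Finset.sum_eq_zero fun k _ => hc k
  obtain ⟨m, rfl, t, s, ht, hs, -⟩ := h.exists_path_eq_of_mem (a := i + 1)
    (by rw [← mul_assoc, ← smul_eq_mul (e (i + 1)), ← map_smul, ← map_smul, hev])
    (by rw [mul_assoc, h.idem]) hk
  have hsoc : IsSoclePath e x (i + 1) m := by
    refine ⟨fun h0 => hk (by rw [ht, h0, mul_zero]), fun j hj => ?_⟩
    rw [hs, ← mul_assoc, ← mul_assoc, ← smul_eq_mul (j * s), ← map_smul,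
      hJz _ (mul_mem_jacobson_right hj s), map_zero, zero_mul]
  -- Continue along injective arrows to a projective injective module; the socle is preserved.
  obtain ⟨m', h1, h2, h3⟩ := h.exists_injective_path (n - (i + 1 + m) - 1) (i + 1 + m)
    (by have := h.lt_of_path_ne_zero hsoc.1; omega)
  exact ⟨m + m', by omega, by rwa [← add_assoc], h.isSoclePath_add hsoc h3⟩

/-- Embed P_i in P_q through P_{i+1}, and let δ extend to P_q the map P_{i+1} → P_t onto the socle
S_{i+1}. Its kernel is rad P_{i+1}, the image of P_i. -/
lemma exists_copresentation (hA : IsNakayama A) (hs : SocleCondition n e x) {i : ℕ} (hi : i < n) :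
    ∃ q < n, ∃ t < n, ¬ ArrowInjective e x q ∧ ¬ ArrowInjective e x t ∧ ∃ p : A,
      e i * p = p ∧ p * e q = p ∧ (∀ r, r * e i = r → r * p = 0 → r = 0) ∧
      ∃ δ : Submodule.span A {e q} →ₗ[A] Submodule.span A {e t},
        ∀ y, δ y = 0 ↔ ∃ r, (y : A) = r * p := by
  by_cases hinj : ArrowInjective e x i
  swap
  -- P_i is already injective: use the identity followed by zero.
  · refine ⟨i, hi, i, hi, hinj, hinj, e i, h.idem i, h.idem i,
      fun r hr h0 => by rwa [hr] at h0, 0, fun y => ⟨fun _ => ⟨y, ?_⟩, fun _ => rfl⟩⟩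
    exact ((mem_span_idempotent_iff (h.idem i)).1 y.2).symm
  obtain ⟨k, hk, hkinj, hsoc⟩ := hs i hi hinj
  obtain ⟨m, hm, hminj, hpinj⟩ := h.exists_injective_path (n - (i + 1) - 1) (i + 1) (by omega)
  have hw := (mem_span_idempotent_iff (h.idem _)).2 (h.path_mul_e (i + 1) m)
  have hz := (mem_span_idempotent_iff (h.idem _)).2 (h.path_mul_e (i + 1) k)
  have hwinj : Function.Injective (rightMul (e (i + 1)) hw) := by
    rw [injective_iff_map_eq_zero]
    intro y hy
    exact Subtype.ext (hpinj y ((mem_span_idempotent_iff (h.idem _)).1 y.2)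
      (congrArg Subtype.val hy))
  obtain ⟨δ, hδ⟩ := (h.injective_of_not_arrowInjective hA hk hkinj).out _ hwinj
    (rightMul (e (i + 1)) hz)
  have hδ' : ∀ s (y : Submodule.span A {e (i + 1 + m)}), (y : A) = s * path e x (i + 1) m →
      (δ y : A) = s * path e x (i + 1) k := by
    intro s y hy
    have h1 := hδ (s • ⟨e (i + 1), Submodule.mem_span_singleton_self _⟩)
    have h2 : rightMul (e (i + 1)) hw (s • ⟨e (i + 1), Submodule.mem_span_singleton_self _⟩) = y :=
      Subtype.ext (by
        rw [hy, coe_rightMul, Submodule.coe_smul, smul_eq_mul, mul_assoc, h.e_mul_path])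
    rw [← h2, h1, coe_rightMul, Submodule.coe_smul, smul_eq_mul, mul_assoc, h.e_mul_path]
  refine ⟨i + 1 + m, hm, i + 1 + k, hk, hminj, hkinj, path e x i (m + 1), h.e_mul_path _ _, ?_, ?_,
    δ, fun y => ⟨fun hy => ?_, ?_⟩⟩
  · convert h.path_mul_e i (m + 1) using 3
    omega
  · intro r hr h0
    rw [h.path_succ, ← mul_assoc] at h0
    exact hinj r hr (hpinj _ (by rw [mul_assoc, h.x_mul_e]) h0)
  · rcases h.uniserial _ _ _ ((mem_span_idempotent_iff (h.idem _)).1 y.2)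
      (h.path_mul_e (i + 1) m) with ⟨s, hsy⟩ | ⟨s, hsy⟩
    · have hsz : (s * e (i + 1)) * path e x (i + 1) k = 0 := by
        rw [mul_assoc, h.e_mul_path, ← hδ' s y hsy, hy]
        rfl
      have hsJ : s * e (i + 1) ∈ Ring.jacobson A := by
        by_contra hsJ
        obtain ⟨t, ht, -⟩ := (h.uniserial (i + 1)).exists_mul_eq (h.idem _)
          (by rw [mul_assoc, h.idem]) hsJ
        apply hsoc.1
        rw [← h.e_mul_path, ← ht, mul_assoc, hsz, mul_zero]
      obtain ⟨r, hr⟩ := h.exists_eq_mul_x i _ hsJ (by rw [mul_assoc, h.idem])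
      exact ⟨r, by rw [hsy, h.path_succ, ← mul_assoc, ← hr, mul_assoc, h.e_mul_path]⟩
    -- Here A y contains the image of P_{i+1}, on which δ is nonzero.
    · refine absurd ?_ hsoc.1
      have h1 := hδ' 1 (s • y) (by rw [Submodule.coe_smul, smul_eq_mul, ← hsy, one_mul])
      rw [map_smul, hy, smul_zero, one_mul] at h1
      exact h1.symm
  · rintro ⟨r, hr⟩
    apply Subtype.ext
    rw [hδ' (r * x i) y (by rw [hr, h.path_succ, mul_assoc]), mul_assoc,
      hsoc.2 _ (h.x_mem i), mul_zero]
    rfl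

lemma two_le_of_socleCondition (hA : IsNakayama A) (hs : SocleCondition n e x) :
    2 ≤ dominantDimension A A := by
  choose q hq t ht hqi hti p hep hpe hp δ hδ using
    fun i : Fin n => h.exists_copresentation hA hs i.2
  have hpm : ∀ i, p i ∈ Submodule.span A {e (q i)} := fun i =>
    (mem_span_idempotent_iff (h.idem _)).2 (hpe i)
  have hqI := fun i => h.injective_of_not_arrowInjective hA (hq i) (hqi i)
  have htI := fun i => h.injective_of_not_arrowInjective hA (ht i) (hti i)
  have hqP := fun i => projective_span_idempotent (h.idem (q i))
  have htP := fun i => projective_span_idempotent (h.idem (t i))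
  have hsum : ∑ i : Fin n, e i = 1 := by
    rw [← h.sum_eq_one, Finset.sum_range]
  let f : A →ₗ[A] (∀ i, Submodule.span A {e (q i)}) :=
    LinearMap.pi fun i => (LinearMap.toSpanSingleton A A (p i)).codRestrict _
      fun a => Submodule.smul_mem _ a (hpm i)
  have hf : ∀ a i, (f a i : A) = a * p i := fun a i => rfl
  refine two_le_dominantDimension_of_exact inferInstance (projective_pi _) inferInstance
    (projective_pi _) f (LinearMap.pi fun i => δ i ∘ₗ LinearMap.proj i) ?_ fun y => ?_
  · rw [injective_iff_map_eq_zero]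
    intro a ha
    rw [← mul_one a, ← hsum, Finset.mul_sum]
    refine Finset.sum_eq_zero fun i _ => hp i _ (by rw [mul_assoc, h.idem]) ?_
    rw [mul_assoc, hep, ← hf, ha]
    rfl
  · have hy : (LinearMap.pi fun i => δ i ∘ₗ LinearMap.proj i) y = 0 ↔ ∀ i, δ i (y i) = 0 :=
      funext_iff
    rw [hy]
    constructor
    · intro h0
      choose r hr using fun i => (hδ i (y i)).1 (h0 i)
      -- Since p_k = e_k p_k, orthogonality leaves only the k-th summand in component k.
      refine ⟨∑ i : Fin n, r i * e i, funext fun k => Subtype.ext ?_⟩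
      rw [hf, Finset.sum_mul, hr, Finset.sum_eq_single k]
      · rw [mul_assoc, hep]
      · intro b _ hb
        rw [← hep k, mul_assoc, ← mul_assoc (e b), h.ortho _ _ (fun hbk => hb (Fin.ext hbk)),
          zero_mul, mul_zero]
      · simp
    · rintro ⟨a, rfl⟩ i
      exact (hδ i _).2 ⟨a, hf a i⟩

lemma two_le_dominantDimension_iff_socleCondition (hA : IsNakayama A) :
    2 ≤ dominantDimension A A ↔ SocleCondition n e x :=
  ⟨h.socleCondition_of_two_le, h.two_le_of_socleCondition hA⟩

end IsPathSystem
end Copresentation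

/-! ### From linear Nakayama algebras to path systems, and from socles to admissible sequences. -/

section LinearNakayama

variable {A : Type u} [Ring A] {n : ℕ}

/-- The idempotents of a family indexed by `Fin n`, extended by zero to all natural numbers. -/
def vertex (e : Fin n → A) (k : ℕ) : A := if hk : k < n then e ⟨k, hk⟩ else 0

lemma vertex_of_lt (e : Fin n → A) {k : ℕ} (hk : k < n) : vertex e k = e ⟨k, hk⟩ := dif_pos hk

@[simp] lemma vertex_val (e : Fin n → A) (i : Fin n) : vertex e i = e i := dif_pos i.2

lemma vertex_of_ge (e : Fin n → A) {k : ℕ} (hk : n ≤ k) : vertex e k = 0 := dif_neg (by omega)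

lemma jacobson_sq : Ring.jacobson A ^ 2 = Ring.jacobson A * Ring.jacobson A := by
  rw [Submodule.pow_succ, Submodule.pow_one]

variable {e : Fin n → A}

namespace IsLinearNakayama

variable (hA : IsLinearNakayama e)
include hA

lemma vertex_idem (a : ℕ) : vertex e a * vertex e a = vertex e a := by
  rcases lt_or_ge a n with ha | ha
  · rw [vertex_of_lt e ha]
    exact hA.basic.complete.idem ⟨a, ha⟩
  · simp [vertex_of_ge e ha]

lemma ne_zero (i : Fin n) : e i ≠ 0 := by
  intro h0
  have := (hA.basic.indecomposable i).1
  rw [proj, Submodule.nontrivial_iff_ne_bot] at this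
  exact this (Submodule.span_singleton_eq_bot.2 h0)

lemma sum_vertex : ∑ i ∈ Finset.range n, vertex e i = 1 := by
  rw [Finset.sum_range, ← hA.basic.complete.complete]
  exact Finset.sum_congr rfl fun i _ => vertex_val e i

lemma uniserialAt (a : ℕ) : UniserialAt (vertex e a) := by
  intro y z hy hz
  rcases lt_or_ge a n with ha | ha
  · have he := hA.vertex_idem a
    have huni := hA.nakayama.projective (proj e ⟨a, ha⟩) (by
      rw [proj, ← vertex_of_lt e ha]
      exact projective_span_idempotent he) (hA.basic.indecomposable _)
    rw [proj, ← vertex_of_lt e ha] at huni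
    rcases huni.smul_or_smul ⟨y, (mem_span_idempotent_iff he).2 hy⟩
      ⟨z, (mem_span_idempotent_iff he).2 hz⟩ with ⟨r, hr⟩ | ⟨r, hr⟩
    · exact .inl ⟨r, congrArg Subtype.val hr⟩
    · exact .inr ⟨r, congrArg Subtype.val hr⟩
  · exact .inl ⟨0, by rw [← hy, vertex_of_ge e ha]; simp⟩

/-- Outside the radical, y would be invertible and give an isomorphism P_a ≅ P_b. -/
lemma mem_jacobson_of_ne (a b : ℕ) (y : A) (hab : a ≠ b) (hay : vertex e a * y = y)
    (hyb : y * vertex e b = y) : y ∈ Ring.jacobson A := by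
  rcases lt_or_ge a n with ha | ha
  swap
  · rw [← hay, vertex_of_ge e ha, zero_mul]
    exact zero_mem _
  rcases lt_or_ge b n with hb | hb
  swap
  · rw [← hyb, vertex_of_ge e hb, mul_zero]
    exact zero_mem _
  by_contra hJ
  have hea := hA.vertex_idem a
  have heb := hA.vertex_idem b
  obtain ⟨s, hsy, hys, hbs, hsa⟩ := (hA.uniserialAt a).exists_inverse (hA.uniserialAt b) hea heb
    (by rw [vertex_of_lt e hb]; exact hA.ne_zero _) hay hyb hJ
  let φ : Submodule.span A {vertex e a} ≃ₗ[A] Submodule.span A {vertex e b} :=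
    LinearEquiv.ofLinearMap (rightMul _ ((mem_span_idempotent_iff heb).2 hyb))
      (rightMul _ ((mem_span_idempotent_iff hea).2 hsa))
      (LinearMap.ext fun z => Subtype.ext (by
        rw [LinearMap.comp_apply, coe_rightMul, coe_rightMul, mul_assoc, hsy]
        exact (mem_span_idempotent_iff heb).1 z.2))
      (LinearMap.ext fun z => Subtype.ext (by
        rw [LinearMap.comp_apply, coe_rightMul, coe_rightMul, mul_assoc, hys]
        exact (mem_span_idempotent_iff hea).1 z.2))
  have hiso : Nonempty (proj e ⟨a, ha⟩ ≃ₗ[A] proj e ⟨b, hb⟩) := by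
    rw [proj, proj, ← vertex_of_lt e ha, ← vertex_of_lt e hb]
    exact ⟨φ⟩
  exact hab (congrArg Fin.val (hA.basic.eq_of_iso _ _ hiso))

/-- Choose x outside rad². If e_k y ∉ A x for a radical y, uniseriality gives x = r e_k y; as x ∉
rad², r e_k is not radical and can be cancelled, a contradiction. -/
lemma exists_arrow (a : ℕ) : ∃ x, vertex e a * x = x ∧ x * vertex e (a + 1) = x ∧
    x ∈ Ring.jacobson A ∧
    ∀ y ∈ Ring.jacobson A, y * vertex e (a + 1) = y → ∃ r, y = r * x := by
  rcases lt_or_ge (a + 1) n with ha | ha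
  swap
  · refine ⟨0, by simp, by simp, zero_mem _, fun y _ hy => ⟨0, ?_⟩⟩
    rw [← hy, vertex_of_ge e ha]
    simp
  obtain ⟨x, hx, hx2⟩ := (hA.arrow_iff ⟨a + 1, ha⟩ ⟨a, by omega⟩).2 rfl
  rw [← vertex_of_lt e, ← vertex_of_lt e] at hx2
  refine ⟨vertex e a * x * vertex e (a + 1), ?_, ?_,
    mul_mem_jacobson_right (mul_mem_jacobson_left hx _) _, fun y hy hye => ?_⟩
  · rw [← mul_assoc, ← mul_assoc, hA.vertex_idem]
  · rw [mul_assoc, hA.vertex_idem]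
  have key : ∀ k, ∃ r, vertex e k * y = r * (vertex e a * x * vertex e (a + 1)) := by
    intro k
    rcases hA.uniserialAt (a + 1) (vertex e k * y) (vertex e a * x * vertex e (a + 1))
      (by rw [mul_assoc, hye]) (by rw [mul_assoc, hA.vertex_idem]) with hr | ⟨r, hr⟩
    · exact hr
    have hr' : vertex e a * x * vertex e (a + 1) = r * vertex e k * y := by rw [hr, mul_assoc]
    have hJ : r * vertex e k ∉ Ring.jacobson A := by
      intro hJ
      apply hx2
      rw [hr', jacobson_sq]
      exact Ideal.mul_mem_mul hJ hy
    obtain ⟨s, hs, -⟩ := (hA.uniserialAt k).exists_mul_eq (hA.vertex_idem k)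
      (by rw [mul_assoc, hA.vertex_idem]) hJ
    exact ⟨s, by rw [hr', ← mul_assoc, hs]⟩
  choose r hr using key
  refine ⟨∑ k ∈ Finset.range n, r k, ?_⟩
  rw [Finset.sum_mul]
  nth_rewrite 1 [← one_mul y]
  rw [← hA.sum_vertex, Finset.sum_mul]
  exact Finset.sum_congr rfl fun k _ => hr k

/-- No arrow starts at vertex 0, so rad e_0 = rad² e_0, which vanishes by Nakayama's lemma. -/
lemma radical_mul_vertex_zero [IsNoetherianRing A] (y : A) (hy : y ∈ Ring.jacobson A) :
    y * vertex e 0 = 0 := by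
  rcases Nat.eq_zero_or_pos n with hn | hn
  · rw [vertex_of_ge e hn.le, mul_zero]
  have hsq : ∀ y ∈ Ring.jacobson A, y * vertex e 0 ∈ Ring.jacobson A ^ 2 := by
    intro y hy
    rw [← one_mul y, ← hA.sum_vertex, Finset.sum_mul, Finset.sum_mul]
    refine Submodule.sum_mem _ fun k hk => ?_
    by_contra hc
    have hk' := Finset.mem_range.1 hk
    rw [vertex_of_lt e hk', vertex_of_lt e hn] at hc
    have := (hA.arrow_iff ⟨0, hn⟩ ⟨k, hk'⟩).1 ⟨y, hy, hc⟩
    simp at this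
  let f := LinearMap.toSpanSingleton A A (vertex e 0)
  have hbot : Submodule.map f (Ring.jacobson A) = ⊥ := by
    have hfg : (Submodule.map f (Ring.jacobson A)).FG := IsNoetherian.noetherian _
    apply hfg.eq_bot_of_le_jacobson_smul
    rw [← Submodule.map_smul'']
    rintro _ ⟨j, hj, rfl⟩
    refine ⟨j * vertex e 0, ?_, ?_⟩
    · have := hsq j hj
      rwa [jacobson_sq] at this
    · simp [f, mul_assoc, hA.vertex_idem]
  have : f y ∈ Submodule.map f (Ring.jacobson A) := ⟨y, hy, rfl⟩
  rw [hbot] at this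
  exact this

lemma exists_isPathSystem [IsNoetherianRing A] : ∃ x, IsPathSystem n (vertex e) x := by
  choose x h1 h2 h3 h4 using hA.exists_arrow
  refine ⟨x, hA.vertex_idem, fun a b hab => ?_, hA.sum_vertex, fun a ha => ?_,
    fun a ha => vertex_of_ge e ha, hA.uniserialAt, hA.mem_jacobson_of_ne, h1, h2, h3, h4,
    hA.radical_mul_vertex_zero⟩
  · rcases lt_or_ge a n with ha | ha
    · rcases lt_or_ge b n with hb | hb
      · rw [vertex_of_lt e ha, vertex_of_lt e hb]
        exact hA.basic.complete.ortho fun hc => hab (congrArg Fin.val hc)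
      · rw [vertex_of_ge e hb, mul_zero]
    · rw [vertex_of_ge e ha, zero_mul]
  · rw [vertex_of_lt e ha]
    exact hA.ne_zero _

end IsLinearNakayama

lemma val_add_one_cases [NeZero n] (i : Fin n) :
    ((i : ℕ) + 1 < n ∧ ((i + 1 : Fin n) : ℕ) = i + 1) ∨
      ((i : ℕ) + 1 = n ∧ ((i + 1 : Fin n) : ℕ) = 0) := by
  have h1 : ((i + 1 : Fin n) : ℕ) = (i + 1) % n := by simp [Fin.val_add]
  rcases Nat.lt_or_ge ((i : ℕ) + 1) n with hi | hi
  · exact .inl ⟨hi, by rw [h1, Nat.mod_eq_of_lt hi]⟩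
  · have : (i : ℕ) + 1 = n := by omega
    exact .inr ⟨this, by rw [h1, this, Nat.mod_self]⟩

namespace IsPathSystem

variable {x : ℕ → A} (h : IsPathSystem n (vertex e) x)
include h

lemma coe_admissibleSequence (i : Fin n) :
    (admissibleSequence e i : ℕ∞) = Module.length A (Submodule.span A {vertex e i}) := by
  obtain ⟨a, m, hab, hs⟩ := h.exists_isSoclePath_vertex i.2
  have hl := h.length_of_isSoclePath hs
  rw [admissibleSequence, proj, ← vertex_val e]
  rw [hab] at hl
  rw [hl]
  rfl

lemma admissibleSequence_of_isSoclePath {a m : ℕ} (hs : IsSoclePath (vertex e) x a m) (i : Fin n)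
    (hi : a + m = i) : admissibleSequence e i = m + 1 := by
  have h1 := h.coe_admissibleSequence i
  rw [← hi, h.length_of_isSoclePath hs] at h1
  exact_mod_cast h1

lemma admissibleSequence_pos (i : Fin n) : 0 < admissibleSequence e i := by
  obtain ⟨a, m, hab, hs⟩ := h.exists_isSoclePath_vertex i.2
  rw [h.admissibleSequence_of_isSoclePath hs i hab]
  omega

lemma admissibleSequence_add_one [NeZero n] (i : Fin n) :
    (ArrowInjective (vertex e) x i → admissibleSequence e (i + 1) = admissibleSequence e i + 1) ∧
    (¬ ArrowInjective (vertex e) x i →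
      admissibleSequence e (i + 1) ≤ admissibleSequence e i) := by
  have h1 := h.coe_admissibleSequence i
  have h2 := h.coe_admissibleSequence (i + 1)
  rcases val_add_one_cases i with ⟨hi, hv⟩ | ⟨hi, hv⟩
  · rw [hv] at h2
    constructor
    · intro hinj
      rw [h.length_succ_of_arrowInjective i.2 hinj, ← h1] at h2
      exact_mod_cast h2
    · intro hinj
      have := h.length_succ_le_of_not_arrowInjective hi hinj
      rw [← h1, ← h2] at this
      exact_mod_cast this
  -- At the last vertex the cyclic successor is vertex 0, whose projective is simple, so c_{n+1} =
  -- c_1 = 1.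
  · refine ⟨fun hinj => absurd hinj (h.not_arrowInjective_of_le i.2 hi.ge), fun _ => ?_⟩
    rw [hv, h.length_zero_vertex (by omega)] at h2
    have h3 : admissibleSequence e (i + 1) = 1 := by exact_mod_cast h2
    rw [h3]
    exact h.admissibleSequence_pos i

lemma mem_indexP_iff [NeZero n] (i : Fin n) :
    i ∈ indexP (admissibleSequence e) ↔ ArrowInjective (vertex e) x i := by
  obtain ⟨h1, h2⟩ := h.admissibleSequence_add_one i
  refine ⟨fun hi => ?_, h1⟩
  by_contra hc
  have h3 : admissibleSequence e (i + 1) = admissibleSequence e i + 1 := hi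
  have := h2 hc
  omega

lemma mem_indexQ_iff [NeZero n] (i : Fin n) :
    i ∈ indexQ (admissibleSequence e) ↔ ¬ ArrowInjective (vertex e) x i := by
  obtain ⟨h1, h2⟩ := h.admissibleSequence_add_one i
  refine ⟨fun hi hc => ?_, h2⟩
  have h3 : admissibleSequence e (i + 1) ≤ admissibleSequence e i := hi
  have := h1 hc
  omega

lemma socleCondition_iff [NeZero n] : SocleCondition n (vertex e) x ↔
    {x : ℤ | ∃ i ∈ indexP (admissibleSequence e), x = label i} ⊆
      {x : ℤ | ∃ j ∈ indexQ (admissibleSequence e),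
        x = label j - (admissibleSequence e j : ℤ)} := by
  constructor
  · rintro hs _ ⟨i, hi, rfl⟩
    obtain ⟨m, hm, hninj, hsoc⟩ := hs i i.2 ((h.mem_indexP_iff i).1 hi)
    refine ⟨⟨i + 1 + m, hm⟩, (h.mem_indexQ_iff _).2 hninj, ?_⟩
    -- In labels, j = i + 1 + m and c_j = m + 1, so j - c_j = i.
    rw [h.admissibleSequence_of_isSoclePath hsoc _ rfl]
    simp only [label]
    push_cast
    ring
  · intro hsub i hi hinj
    obtain ⟨j, hj, hij⟩ := hsub ⟨⟨i, hi⟩, (h.mem_indexP_iff ⟨i, hi⟩).2 hinj, rfl⟩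
    obtain ⟨a, m, hab, hs⟩ := h.exists_isSoclePath_vertex j.2
    rw [h.admissibleSequence_of_isSoclePath hs j hab] at hij
    have hnj := (h.mem_indexQ_iff j).1 hj
    simp only [label] at hij
    obtain rfl : a = i + 1 := by omega
    rw [← hab] at hnj
    exact ⟨m, hab ▸ j.2, hnj, hs⟩

end IsPathSystem
end LinearNakayama

end NakayamaDomDim

theorem mainTheorem11 {R : Type v} {A : Type u} [CommRing R] [IsArtinianRing R] [Ring A]
    [Algebra R A] [Module.Finite R A] {n : ℕ} [NeZero n] (e : Fin n → A)
    (hA : NakayamaDomDim.IsLinearNakayama e) (c : Fin n → ℕ)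
    (hc : c = NakayamaDomDim.admissibleSequence e) :
    2 ≤ NakayamaDomDim.dominantDimension A A ↔
      {x : ℤ | ∃ i ∈ NakayamaDomDim.indexP c, x = NakayamaDomDim.label i} ⊆
        {x : ℤ | ∃ j ∈ NakayamaDomDim.indexQ c, x = NakayamaDomDim.label j - (c j : ℤ)} := by
  have : IsArtinianRing A := IsArtinianRing.of_finite R A
  obtain ⟨x, h⟩ := hA.exists_isPathSystem
  subst hc
  rw [h.two_le_dominantDimension_iff_socleCondition hA.nakayama, h.socleCondition_iff]
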